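/- Let $\Gamma$ be a finite non-abelian group, and let $\widehat\Gamma$ be its dual finite quantum group: $C(\widehat\Gamma)=\mathcal O(\widehat\Gamma)=\mathbb C[\Gamma]$ with $\lambda_g^*=\lambda_{g^{-1}}$, $\Delta(\lambda_g)=\lambda_g\otimes\lambda_g$, and the Haar functional $\psi$ normalised by $\psi(\lambda_1)=|\Gamma|$, $\psi(\lambda_g)=0$ for $g\ne 1$. (Then $mm^*=\mathrm{id}$, where $m$ is the multiplication and $m^*$ its adjoint for the inner product $\langle x,y\rangle=\psi(x^*y)$.) For $P\in\mathbb C[\Gamma]$ let $A_P=P\star\cdot=(\psi(S(P)\,\cdot\,)\otimes\mathrm{id})\circ\Delta$ be the operator of convolution by $P$, with $S$ the antipode. Then there is an orthogonal projection $P=\sum_{g}T(g)\lambda_g\in\mathbb C[\Gamma]$ such that $(\widehat\Gamma,A_P)$ is a (directed) quantum graph, i.e. $m(A_P\otimes A_P)m^*=A_P$ and $A_P(f^*)^*=A_P(f)$ for all $f$ (this is the quantum Cayley graph of $P$), and its quantum automorphism group $\mathrm{Qut}(\widehat\Gamma,A_P)$ is equal to $\widehat\Gamma$, acting on itself by the comultiplication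 $\Delta$. This means: $\Delta$ is a faithful action of $\widehat\Gamma$ on $(\widehat\Gamma,A_P)$, and for every action $\beta\colon\mathbb C[\Gamma]\to\mathbb C[\Gamma]\otimes\mathcal O(\mathbb H)$ of a compact quantum group $\mathbb H$ on $(\widehat\Gamma,A_P)$ there is a unique Hopf $^*$-algebra morphism $\gamma\colon\mathbb C[\Gamma]\to\mathcal O(\mathbb H)$ with $(\mathrm{id}\otimes\gamma)\circ\Delta=\beta$. Here a compact quantum group is given by a CQG Hopf $^*$-algebra $\mathcal O(\mathbb H)$, and an action on $(\widehat\Gamma,A_P)$ is an injective unital $^*$-homomorphism $\beta$ with $(\beta\otimes\mathrm{id})\beta=(\mathrm{id}\otimes\Delta_{\mathbb H})\beta$, $(\psi\otimes\mathrm{id})\beta=\psi(\cdot)1$ and $(A_P\otimes\mathrm{id})\beta=\beta A_P$. Moreover, $P$ can be chosen to have rank one in each block of $\mathbb C[\Gamma]$ of dimension greater than one and to vanish in the one-dimensional blocks (that is, $P$ acts as a rank-one operator in every irreducible complex representation of $\Gamma$ of dimension greater than one, and as $0$ in the one-dimensional ones), and so that its Fourier transform $T$ satisfies $T(g)\neq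 T(h)$ for all $g\neq h$ in $\Gamma$ at least one of which is not central. -/

import Mathlib

open scoped TensorProduct ComplexOrder

universe u v w

noncomputable section

/-! ## Finite quantum sets and quantum graphs -/

section QuantumSets

/-- A finite quantum set: a finite-dimensional unital `*`-algebra `B = C(𝕏)` with a positive,
faithful, tracial functional `ψ` for which the multiplication `m` satisfies `m m* = id`, the adjoint
being taken for the inner product `⟨x, y⟩ = ψ (x* y)`.  A finite-dimensional `*`-algebra with a
faithful positive functional is a C*-algebra in a unique way, and every finite-dimensional
C*-algebra carries exactly one such `ψ` (the tracial `1`-form).  The map `m*` is determined by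
`inner_mulAdj`, since `ψ` is faithful. -/
class FiniteQuantumSet (B : Type u) [Ring B] [StarRing B] [Algebra ℂ B] [StarModule ℂ B] where
  finite : Module.Finite ℂ B
  /-- the functional `ψ` -/
  psi : B →ₗ[ℂ] ℂ
  psi_nonneg : ∀ x : B, 0 ≤ psi (star x * x)
  psi_faithful : ∀ x : B, psi (star x * x) = 0 → x = 0
  psi_tracial : ∀ x y : B, psi (x * y) = psi (y * x)
  /-- the adjoint `m* : B → B ⊗ B` of the multiplication -/
  mulAdj : B →ₗ[ℂ] B ⊗[ℂ] B
  /-- `⟨m* x, y ⊗ z⟩ = ⟨x, y z⟩` -/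
  inner_mulAdj : ∀ x y z : B,
    LinearMap.mul' ℂ ℂ (TensorProduct.map psi psi (star (mulAdj x) * (y ⊗ₜ[ℂ] z)))
      = psi (star x * (y * z))
  /-- `m m* = id` -/
  mul_mulAdj : ∀ x : B, LinearMap.mul' ℂ B (mulAdj x) = x

variable {B : Type u} [Ring B] [StarRing B] [Algebra ℂ B] [StarModule ℂ B] [FiniteQuantumSet B]

/-- The Schur product `A₁ • A₂ = m (A₁ ⊗ A₂) m*`. -/
def schurProduct (A₁ A₂ : B →ₗ[ℂ] B) : B →ₗ[ℂ] B :=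
  LinearMap.mul' ℂ B ∘ₗ TensorProduct.map A₁ A₂ ∘ₗ FiniteQuantumSet.mulAdj

/-- `(𝕏, A)` is a (directed) quantum graph: the quantum adjacency matrix `A` is a real Schur
idempotent, `A • A = A = Ā`, where `Ā f = (A f*)*`. -/
structure IsQuantumGraph (A : B →ₗ[ℂ] B) : Prop where
  schur_idempotent : schurProduct A A = A
  real : ∀ f : B, star (A (star f)) = A f

end QuantumSets

/-! ## Compact quantum groups and their actions -/

/-- A square matrix over a Hopf `*`-algebra is a unitary (finite-dimensional) representation of the
quantum group: `Δ u_{ij} = ∑_k u_{ik} ⊗ u_{kj}` and `U` is unitary. -/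
structure IsUnitaryRep {H : Type v} [Ring H] [StarRing H] [HopfAlgebra ℂ H] {n : ℕ}
    (U : Matrix (Fin n) (Fin n) H) : Prop where
  comul_apply : ∀ i j, Coalgebra.comul (R := ℂ) (U i j) = ∑ k, U i k ⊗ₜ[ℂ] U k j
  mul_star_self : U * star U = 1
  star_mul_self : star U * U = 1

/-- A CQG Hopf `*`-algebra `𝒪(ℍ)` (an algebraic compact quantum group): a Hopf algebra over `ℂ` with
an involution for which the comultiplication is a `*`-homomorphism, linearly spanned by the matrix
entries of its finite-dimensional unitary representations. -/
class CQGAlgebra (H : Type v) [Ring H] [StarRing H] [HopfAlgebra ℂ H] [StarModule ℂ H] : Prop where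
  comul_star : ∀ x : H, Coalgebra.comul (R := ℂ) (star x) = star (Coalgebra.comul (R := ℂ) x)
  span_coefficients :
    Submodule.span ℂ {x : H | ∃ (n : ℕ) (U : Matrix (Fin n) (Fin n) H),
      IsUnitaryRep U ∧ ∃ i j, U i j = x} = ⊤

/-- An action of a compact quantum group `ℍ` on the finite quantum space with algebra `B`: an
injective unital `*`-homomorphism `α : B → B ⊗ 𝒪(ℍ)` with `(α ⊗ id) α = (id ⊗ Δ) α`. -/
structure QuantumAction (B : Type u) [Ring B] [StarRing B] [Algebra ℂ B] [StarModule ℂ B]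
    (H : Type v) [Ring H] [StarRing H] [HopfAlgebra ℂ H] [StarModule ℂ H] where
  /-- the map `α` -/
  hom : B →⋆ₐ[ℂ] B ⊗[ℂ] H
  injective : Function.Injective hom
  action_eq : ∀ x : B,
    TensorProduct.assoc ℂ B H H
        (TensorProduct.map hom.toAlgHom.toLinearMap (LinearMap.id : H →ₗ[ℂ] H) (hom x))
      = TensorProduct.map (LinearMap.id : B →ₗ[ℂ] B) (Coalgebra.comul (R := ℂ) (A := H)) (hom x)

section Actions

variable {B : Type u} [Ring B] [StarRing B] [Algebra ℂ B] [StarModule ℂ B]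
variable {H : Type v} [Ring H] [StarRing H] [HopfAlgebra ℂ H] [StarModule ℂ H]

/-- The slice `(ω ⊗ id) (α a)` of an action. -/
def QuantumAction.slice (α : QuantumAction B H) (ω : B →ₗ[ℂ] ℂ) (a : B) : H :=
  TensorProduct.lid ℂ H (TensorProduct.map ω (LinearMap.id : H →ₗ[ℂ] H) (α.hom a))

/-- The action is faithful: the slices generate `𝒪(ℍ)`.  (For an action of a CQG Hopf `*`-algebra
the `*`-subalgebra generated by the slices is automatically a Hopf `*`-subalgebra.) -/
def QuantumAction.IsFaithful (α : QuantumAction B H) : Prop :=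
  StarAlgebra.adjoin ℂ {h : H | ∃ (ω : B →ₗ[ℂ] ℂ) (a : B), α.slice ω a = h} = ⊤

/-- The action `α` is an action on the quantum graph `(𝕏, A)`: it preserves the functional `ψ`,
`(ψ ⊗ id) α = ψ(·) 1`, and the quantum adjacency matrix, `(A ⊗ id) α = α A`. -/
structure QuantumAction.IsGraphAction [FiniteQuantumSet B] (A : B →ₗ[ℂ] B)
    (α : QuantumAction B H) : Prop where
  preserves_psi : ∀ x : B,
    α.slice FiniteQuantumSet.psi x = algebraMap ℂ H (FiniteQuantumSet.psi x)
  preserves_adjacency : ∀ x : B,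
    TensorProduct.map A (LinearMap.id : H →ₗ[ℂ] H) (α.hom x) = α.hom (A x)

/-- The compact quantum group `ℍ`, acting through `α`, is the quantum automorphism group
`Qut(𝕏, A)` of the quantum graph `(𝕏, A)`: it acts faithfully on `(𝕏, A)`, and for every action `β`
of a compact quantum group `𝕂` on `(𝕏, A)` there is exactly one Hopf `*`-algebra morphism
`γ : 𝒪(ℍ) → 𝒪(𝕂)` with `(id ⊗ γ) α = β`. -/
structure IsQuantumAutomorphismGroup [FiniteQuantumSet B] (A : B →ₗ[ℂ] B) [CQGAlgebra H]
    (α : QuantumAction B H) : Prop where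
  isGraphAction : α.IsGraphAction A
  isFaithful : α.IsFaithful
  universal : ∀ (K : Type w) [Ring K] [StarRing K] [HopfAlgebra ℂ K] [StarModule ℂ K]
    [CQGAlgebra K] (β : QuantumAction B K), β.IsGraphAction A →
      ∃! γ : H →ₐc[ℂ] K, (∀ x : H, γ (star x) = star (γ x)) ∧
        ∀ x : B, TensorProduct.map (LinearMap.id : B →ₗ[ℂ] B)
          (γ : H →ₐ[ℂ] K).toLinearMap (α.hom x) = β.hom x

end Actions

/-! ## Finite quantum groups and quantum Cayley graphs

A finite quantum group `𝔾` is given by a CQG Hopf `*`-algebra `G = C(𝔾) = 𝒪(𝔾)` that is a finite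
quantum set; `ψ` is then its Haar functional, normalised to be the tracial `1`-form. -/

section FiniteQuantumGroups

variable (G : Type u) [Ring G] [StarRing G] [HopfAlgebra ℂ G] [StarModule ℂ G]

/-- The action of a finite quantum group on itself by its comultiplication. -/
def comulAction [CQGAlgebra G] : QuantumAction G G where
  hom := { Bialgebra.comulAlgHom ℂ G with map_star' := CQGAlgebra.comul_star }
  injective := by
    intro x y h
    have h' : Coalgebra.comul (R := ℂ) x = Coalgebra.comul (R := ℂ) y := h
    have h2 := congrArg (TensorProduct.lid ℂ G) (congrArg
      (LinearMap.rTensor G (Coalgebra.counit (R := ℂ) (A := G))) h')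
    simpa using h2
  action_eq := fun x => Coalgebra.coassoc_apply x

variable {G}

/-- The convolution operator `L_ω = (ω ⊗ id) Δ` of a functional `ω`. -/
def convLeft (ω : G →ₗ[ℂ] ℂ) : G →ₗ[ℂ] G :=
  (TensorProduct.lid ℂ G).toLinearMap ∘ₗ TensorProduct.map ω LinearMap.id ∘ₗ Coalgebra.comul

/-- The functional `ψ_x (y) = ψ (x y)`. -/
def psiAt [FiniteQuantumSet G] (x : G) : G →ₗ[ℂ] ℂ :=
  FiniteQuantumSet.psi ∘ₗ LinearMap.mulLeft ℂ x

/-- The operator `A_P = P ⋆ ·` of convolution by `P`, that is `L_{ψ_{S(P)}}` with `S` the antipode: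
for an orthogonal projection `P` this is the adjacency matrix of the quantum Cayley graph of `P`. -/
def cayleyAdjacency [FiniteQuantumSet G] (P : G) : G →ₗ[ℂ] G :=
  convLeft (psiAt (HopfAlgebra.antipode ℂ P))

end FiniteQuantumGroups

/-! ## The dual of a finite group

The dual quantum group `Γ̂` is given by `C(Γ̂) = ℂ[Γ]`, with the usual Hopf algebra structure
`Δ λ_g = λ_g ⊗ λ_g` and the involution `λ_g* = λ_{g⁻¹}`. -/

namespace GroupDual

variable {Γ : Type u} [Group Γ]

/-- The involution of `ℂ[Γ]`: `(∑ c_g λ_g)* = ∑ c̄_g λ_{g⁻¹}`. -/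
instance instStar : Star (MonoidAlgebra ℂ Γ) where
  star x := .ofCoeff ((x.coeff.mapRange star (star_zero ℂ)).mapDomain fun g => g⁻¹)

@[simp]
lemma star_single (g : Γ) (c : ℂ) :
    star (MonoidAlgebra.single g c) = MonoidAlgebra.single g⁻¹ (star c) := by
  apply MonoidAlgebra.coeff_injective
  simp [star]

@[simp]
lemma dual_star_add (x y : MonoidAlgebra ℂ Γ) : star (x + y) = star x + star y := by
  apply MonoidAlgebra.coeff_injective
  change Finsupp.mapDomain _ (Finsupp.mapRange star (star_zero ℂ) (x.coeff + y.coeff)) = _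
  rw [Finsupp.mapRange_add (star_add (R := ℂ)), Finsupp.mapDomain_add]
  rfl

@[simp]
lemma dual_star_zero : star (0 : MonoidAlgebra ℂ Γ) = 0 := by
  apply MonoidAlgebra.coeff_injective
  simp [star]

instance instStarRing : StarRing (MonoidAlgebra ℂ Γ) where
  star_involutive x := by
    induction x using MonoidAlgebra.induction_linear with
    | zero => simp
    | add x y hx hy => rw [dual_star_add, dual_star_add, hx, hy]
    | single g c => simp
  star_mul x y := by
    induction x using MonoidAlgebra.induction_linear with
    | zero => simp
    | add x x' hx hx' => rw [add_mul, dual_star_add, dual_star_add, mul_add, hx, hx']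
    | single g c =>
      induction y using MonoidAlgebra.induction_linear with
      | zero => simp
      | add y y' hy hy' => rw [mul_add, dual_star_add, dual_star_add, add_mul, hy, hy']
      | single h d => simp [MonoidAlgebra.single_mul_single, mul_comm]
  star_add := dual_star_add

instance instStarModule : StarModule ℂ (MonoidAlgebra ℂ Γ) where
  star_smul c x := by
    induction x using MonoidAlgebra.induction_linear with
    | zero => simp
    | add x y hx hy => rw [smul_add, dual_star_add, dual_star_add, smul_add, hx, hy]
    | single g d => simp [MonoidAlgebra.smul_single]

instance instCQGAlgebra : CQGAlgebra (MonoidAlgebra ℂ Γ) where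
  comul_star x := by
    induction x using MonoidAlgebra.induction_linear with
    | zero => simp
    | add x y hx hy => simp only [star_add, map_add, hx, hy]
    | single g c => simp [CommSemiring.comul_apply]
  span_coefficients := by
    rw [eq_top_iff]
    rintro x -
    induction x using MonoidAlgebra.induction_linear with
    | zero => exact Submodule.zero_mem _
    | add x y hx hy => exact Submodule.add_mem _ hx hy
    | single g c =>
      have h : MonoidAlgebra.single g c = c • MonoidAlgebra.single g (1 : ℂ) := by
        simp [MonoidAlgebra.smul_single]
      rw [h]
      refine Submodule.smul_mem _ _ (Submodule.subset_span
        ⟨1, fun _ _ => MonoidAlgebra.single g 1, ⟨?_, ?_, ?_⟩, 0, 0, rfl⟩)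
      · intro i j
        simp
      · ext1 i j
        fin_cases i; fin_cases j
        change ∑ k : Fin 1, MonoidAlgebra.single g (1 : ℂ) * star (MonoidAlgebra.single g (1 : ℂ))
          = 1
        simp [MonoidAlgebra.single_mul_single, MonoidAlgebra.one_def]
      · ext1 i j
        fin_cases i; fin_cases j
        change ∑ k : Fin 1, star (MonoidAlgebra.single g (1 : ℂ)) * MonoidAlgebra.single g (1 : ℂ)
          = 1
        simp [MonoidAlgebra.single_mul_single, MonoidAlgebra.one_def]

/-- The Haar functional of the dual of `Γ`, normalised to be the tracial `1`-form:
`ψ (λ_g) = |Γ|` if `g = 1` and `ψ (λ_g) = 0` otherwise. -/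
def haar (Γ : Type u) [Group Γ] [Fintype Γ] : MonoidAlgebra ℂ Γ →ₗ[ℂ] ℂ :=
  (Fintype.card Γ : ℂ) • (Finsupp.lapply (1 : Γ) ∘ₗ (MonoidAlgebra.coeffLinearEquiv ℂ).toLinearMap)

lemma haar_apply [Fintype Γ] (x : MonoidAlgebra ℂ Γ) :
    haar Γ x = Fintype.card Γ * x.coeff 1 := rfl

/-- The adjoint of the multiplication of `ℂ[Γ]`: `m* λ_g = |Γ|⁻¹ ∑_h λ_h ⊗ λ_{h⁻¹ g}`. -/
def mulAdjoint (Γ : Type u) [Group Γ] [Fintype Γ] :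
    MonoidAlgebra ℂ Γ →ₗ[ℂ] MonoidAlgebra ℂ Γ ⊗[ℂ] MonoidAlgebra ℂ Γ :=
  Finsupp.lsum ℂ (fun g => LinearMap.toSpanSingleton ℂ _ ((Fintype.card Γ : ℂ)⁻¹ • ∑ h : Γ,
      MonoidAlgebra.single h (1 : ℂ) ⊗ₜ[ℂ] MonoidAlgebra.single (h⁻¹ * g) (1 : ℂ)))
    ∘ₗ (MonoidAlgebra.coeffLinearEquiv ℂ).toLinearMap

lemma mulAdjoint_single [Fintype Γ] (g : Γ) (c : ℂ) :
    mulAdjoint Γ (MonoidAlgebra.single g c) = c • (Fintype.card Γ : ℂ)⁻¹ • ∑ h : Γ,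
      MonoidAlgebra.single h (1 : ℂ) ⊗ₜ[ℂ] MonoidAlgebra.single (h⁻¹ * g) (1 : ℂ) := by
  simp [mulAdjoint]

lemma coeff_star (x : MonoidAlgebra ℂ Γ) (g : Γ) : (star x).coeff g = star (x.coeff g⁻¹) := by
  change Finsupp.mapDomain (Equiv.inv Γ) _ g = _
  rw [Finsupp.mapDomain_equiv_apply]
  rfl

lemma coeff_mul_one [Fintype Γ] (x y : MonoidAlgebra ℂ Γ) :
    (x * y).coeff 1 = ∑ g : Γ, x.coeff g * y.coeff g⁻¹ := by
  classical
  induction x using MonoidAlgebra.induction_linear with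
  | zero => simp
  | add x x' hx hx' => simp [add_mul, hx, hx', Finset.sum_add_distrib]
  | single a c =>
    simp [MonoidAlgebra.coeff_single_mul_apply, Finsupp.single_apply]

instance instFiniteQuantumSet [Fintype Γ] : FiniteQuantumSet (MonoidAlgebra ℂ Γ) where
  finite := Module.Finite.equiv (MonoidAlgebra.coeffLinearEquiv ℂ).symm
  psi := haar Γ
  psi_nonneg x := by
    rw [haar_apply, coeff_mul_one]
    refine mul_nonneg (Nat.cast_nonneg _) (Finset.sum_nonneg fun g _ => ?_)
    rw [coeff_star]
    exact star_mul_self_nonneg _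
  psi_faithful x h := by
    rw [haar_apply, coeff_mul_one, mul_eq_zero, or_iff_right (by simp),
      Finset.sum_eq_zero_iff_of_nonneg fun g _ => by
        rw [coeff_star]; exact star_mul_self_nonneg _] at h
    apply MonoidAlgebra.coeff_injective
    ext g
    have := h g⁻¹ (Finset.mem_univ _)
    rw [coeff_star] at this
    simpa using this
  psi_tracial x y := by
    rw [haar_apply, haar_apply, coeff_mul_one, coeff_mul_one]
    congr 1
    refine Fintype.sum_equiv (Equiv.inv Γ) _ _ fun g => ?_
    simp [mul_comm]
  mulAdj := mulAdjoint Γ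
  inner_mulAdj x y z := by
    induction x using MonoidAlgebra.induction_linear with
    | zero => simp
    | add x x' hx hx' => simp only [map_add, star_add, add_mul, hx, hx']
    | single a c =>
      induction y using MonoidAlgebra.induction_linear with
      | zero => simp
      | add y y' hy hy' => simp only [TensorProduct.add_tmul, map_add, mul_add, add_mul, hy, hy']
      | single b d =>
        induction z using MonoidAlgebra.induction_linear with
        | zero => simp
        | add z z' hz hz' => simp only [TensorProduct.tmul_add, map_add, mul_add, hz, hz']
        | single e f =>
          classical
          have h : (Fintype.card Γ : ℂ) ≠ 0 := by simp
          simp only [mulAdjoint_single, star_smul, star_sum, TensorProduct.star_tmul, star_single,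
            Finset.sum_mul, smul_mul_assoc, Algebra.TensorProduct.tmul_mul_tmul,
            MonoidAlgebra.single_mul_single, map_smul, map_sum, TensorProduct.map_tmul,
            LinearMap.mul'_apply, haar_apply, MonoidAlgebra.coeff_single]
          rw [Finset.sum_eq_single b]
          · simp [Finsupp.single_apply, mul_assoc]
            split_ifs <;> ring
          · intro x _ hx
            simp [Finsupp.single_apply, inv_mul_eq_one, hx]
          · simp
  mul_mulAdj x := by
    induction x using MonoidAlgebra.induction_linear with
    | zero => simp
    | add x y hx hy => rw [map_add, map_add, hx, hy]
    | single g c =>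
      have h : (Fintype.card Γ : ℂ) ≠ 0 := by simp
      simp [mulAdjoint_single, MonoidAlgebra.single_mul_single, MonoidAlgebra.smul_single, h]

end GroupDual

end

/-! On the basis of group elements `A_P` is diagonal: it sends `λ_g` to `|Γ| T(g) λ_g`. An action
`β` that commutes with `A_P` preserves its eigenspaces, so if `T` separates a non-central `g` from
every other element, then `β(λ_g) = λ_g ⊗ U_g`. A central `g` is a product of two non-central
elements, since `Γ` is non-abelian, and multiplicativity of `β` extends the formula to it. The `U_g`
are then a multiplicative family of group-like elements, that is, a unique Hopf `*`-morphism out of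
`ℂ[Γ]` (`hom_single_eq`, `existsUnique_bialgHom`).

It remains to find `P`. The condition `T(g) ≠ T(h)` says `ψ(P a) ≠ 0` for `a = λ_{g⁻¹} - λ_{h⁻¹}`,
an element that is not central in `ℂ[Γ]` and so is not scalar in some block. If `P` is a sum of
rank-one projections given by vectors `w_i`, then `ψ(P a)` is a weighted sum of Rayleigh quotients
of the blocks of `a`. With denominators cleared it is polynomial along real lines in `w`. It is not
identically zero, because a matrix with constant Rayleigh quotient is scalar. Finitely many such
functions have a common point where none vanishes (`exists_sum_div_ne_zero`).

The Wedderburn isomorphism `φ` is only an isomorphism of algebras. The adjoint inside a block is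
therefore replaced by a conjugate-linear map `conjCol`, and positivity by the faithfulness of `ψ`.
Conjugate linearity is why only real lines are used. -/

namespace GroupDual

variable {Γ : Type u}

/-! ### Coefficients of tensors over the group basis. -/

section Tensor

variable {K : Type w} [AddCommGroup K] [Module ℂ K]

/-- The coefficient functional `∑ c_h λ_h ↦ c_g`. -/
noncomputable def coeffFunctional (g : Γ) : MonoidAlgebra ℂ Γ →ₗ[ℂ] ℂ :=
  Finsupp.lapply g ∘ₗ (MonoidAlgebra.coeffLinearEquiv ℂ).toLinearMap

lemma coeffFunctional_apply (g : Γ) (x : MonoidAlgebra ℂ Γ) :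
    coeffFunctional g x = x.coeff g := rfl

/-- The slice `∑ λ_h ⊗ c_h ↦ c_g`. -/
noncomputable def coeffSlice (K : Type w) [AddCommGroup K] [Module ℂ K] (g : Γ) :
    MonoidAlgebra ℂ Γ ⊗[ℂ] K →ₗ[ℂ] K :=
  (TensorProduct.lid ℂ K).toLinearMap ∘ₗ TensorProduct.map (coeffFunctional g) LinearMap.id

@[simp]
lemma coeffSlice_tmul (g : Γ) (x : MonoidAlgebra ℂ Γ) (k : K) :
    coeffSlice K g (x ⊗ₜ k) = x.coeff g • k := rfl

lemma sum_single_tmul_coeffSlice [Fintype Γ] (x : MonoidAlgebra ℂ Γ ⊗[ℂ] K) :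
    ∑ g : Γ, MonoidAlgebra.single g (1 : ℂ) ⊗ₜ[ℂ] coeffSlice K g x = x := by
  classical
  induction x using TensorProduct.induction_on with
  | zero => simp
  | add x y hx hy => simp only [map_add, TensorProduct.tmul_add, Finset.sum_add_distrib, hx, hy]
  | tmul a k =>
    simp only [coeffSlice_tmul, ← TensorProduct.smul_tmul, ← TensorProduct.sum_tmul]
    congr 1
    apply MonoidAlgebra.coeff_injective
    ext g
    simp

/-- Allows identities between the `U_g` to be read off from identities of `β`. -/
lemma single_tmul_injective (g : Γ) {k l : K}
    (h : MonoidAlgebra.single g (1 : ℂ) ⊗ₜ[ℂ] k = MonoidAlgebra.single g (1 : ℂ) ⊗ₜ[ℂ] l) :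
    k = l := by
  simpa using congrArg (coeffSlice K g) h

end Tensor

lemma single_eq_smul (g : Γ) (c : ℂ) :
    MonoidAlgebra.single g c = c • MonoidAlgebra.single g (1 : ℂ) := by
  simp [MonoidAlgebra.smul_single]

lemma linearMap_ext {M : Type w} [AddCommGroup M] [Module ℂ M]
    {f f' : MonoidAlgebra ℂ Γ →ₗ[ℂ] M}
    (h : ∀ g, f (MonoidAlgebra.single g 1) = f' (MonoidAlgebra.single g 1)) : f = f' := by
  refine LinearMap.ext fun x => ?_
  induction x using MonoidAlgebra.induction_linear with
  | zero => simp
  | add x y hx hy => rw [map_add, map_add, hx, hy]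
  | single g c => rw [single_eq_smul, map_smul, map_smul, h]

variable [Group Γ]

lemma comulAction_hom_single (g : Γ) (c : ℂ) :
    (comulAction (MonoidAlgebra ℂ Γ)).hom (MonoidAlgebra.single g c)
      = MonoidAlgebra.single g c ⊗ₜ MonoidAlgebra.single g 1 := by
  change Coalgebra.comul (R := ℂ) (MonoidAlgebra.single g c) = _
  rw [single_eq_smul g c, map_smul, ← TensorProduct.smul_tmul']
  simp

lemma isFaithful_comulAction : (comulAction (MonoidAlgebra ℂ Γ)).IsFaithful := by
  unfold QuantumAction.IsFaithful
  rw [eq_top_iff]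
  rintro x -
  induction x using MonoidAlgebra.induction_linear with
  | zero => exact zero_mem _
  | add x y hx hy => exact add_mem hx hy
  | single g c =>
    rw [single_eq_smul]
    refine SMulMemClass.smul_mem c (StarAlgebra.subset_adjoin ℂ _
      ⟨coeffFunctional g, MonoidAlgebra.single g 1, ?_⟩)
    rw [QuantumAction.slice, comulAction_hom_single]
    simp [coeffFunctional_apply]

/-! ### Diagonal actions and Hopf morphisms out of the group algebra. -/

section UniqueMorphism

variable {K : Type w} [Ring K] [StarRing K] [HopfAlgebra ℂ K] [StarModule ℂ K]
  {β : QuantumAction (MonoidAlgebra ℂ Γ) K}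

/-- A multiplicative family of group-like elements induces a unique morphism of Hopf algebras. -/
lemma existsUnique_bialgHom
    (hβ : ∀ g, β.hom (MonoidAlgebra.single g 1)
      = MonoidAlgebra.single g 1 ⊗ₜ coeffSlice K g (β.hom (MonoidAlgebra.single g 1))) :
    ∃! γ : MonoidAlgebra ℂ Γ →ₐc[ℂ] K, (∀ x, γ (star x) = star (γ x)) ∧
      ∀ x : MonoidAlgebra ℂ Γ,
        TensorProduct.map (LinearMap.id : MonoidAlgebra ℂ Γ →ₗ[ℂ] MonoidAlgebra ℂ Γ)
          (γ : MonoidAlgebra ℂ Γ →ₐ[ℂ] K).toLinearMap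
          ((comulAction (MonoidAlgebra ℂ Γ)).hom x) = β.hom x := by
  let U : Γ → K := fun g => coeffSlice K g (β.hom (MonoidAlgebra.single g 1))
  have hU : ∀ g, β.hom (MonoidAlgebra.single g 1) = MonoidAlgebra.single g 1 ⊗ₜ U g := hβ
  have hone : U 1 = 1 := by
    apply single_tmul_injective (1 : Γ)
    rw [← hU, ← MonoidAlgebra.one_def, map_one]
    rfl
  have hmul : ∀ g h, U (g * h) = U g * U h := by
    intro g h
    apply single_tmul_injective (g * h)
    have : (MonoidAlgebra.single (g * h) (1 : ℂ) : MonoidAlgebra ℂ Γ)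
        = MonoidAlgebra.single g 1 * MonoidAlgebra.single h 1 := by
      simp [MonoidAlgebra.single_mul_single]
    rw [← hU, this, map_mul, hU, hU, Algebra.TensorProduct.tmul_mul_tmul]
  have hstar : ∀ g, U g⁻¹ = star (U g) := by
    intro g
    apply single_tmul_injective g⁻¹
    have : (MonoidAlgebra.single g⁻¹ (1 : ℂ) : MonoidAlgebra ℂ Γ)
        = star (MonoidAlgebra.single g 1) := by simp
    rw [← hU, this, map_star, hU, TensorProduct.star_tmul]
  have hcomul : ∀ g, Coalgebra.comul (R := ℂ) (U g) = U g ⊗ₜ[ℂ] U g := by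
    intro g
    apply single_tmul_injective g
    have h1 := β.action_eq (MonoidAlgebra.single g 1)
    rw [hU, TensorProduct.map_tmul, TensorProduct.map_tmul] at h1
    refine h1.symm.trans ?_
    change TensorProduct.assoc ℂ _ K K (β.hom (MonoidAlgebra.single g 1) ⊗ₜ U g) = _
    rw [hU]
    rfl
  -- The counit axiom applied to `Δ U = U ⊗ U` gives `ε(U)² = ε(U)`, and `ε(U) ≠ 0` because `U g` is
  -- invertible with inverse `U g⁻¹`.
  have hcounit : ∀ g, Coalgebra.counit (R := ℂ) (U g) = 1 := by
    intro g
    have h1 := congrArg (LinearMap.rTensor K (Coalgebra.counit (R := ℂ) (A := K))) (hcomul g)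
    rw [Coalgebra.rTensor_counit_comul, LinearMap.rTensor_tmul] at h1
    have h2 := congrArg (Coalgebra.counit (R := ℂ) (A := K))
      (congrArg (TensorProduct.lid ℂ K) h1)
    simp only [TensorProduct.lid_tmul, one_smul, map_smul, smul_eq_mul] at h2
    have h3 : Coalgebra.counit (R := ℂ) (U g) * Coalgebra.counit (R := ℂ) (U g⁻¹) = 1 := by
      rw [← Bialgebra.counit_mul, ← hmul, mul_inv_cancel, hone, Bialgebra.counit_one]
    have h4 : Coalgebra.counit (R := ℂ) (U g) ≠ 0 := left_ne_zero_of_mul_eq_one h3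
    exact (mul_eq_left₀ h4).1 h2.symm
  let φ : MonoidAlgebra ℂ Γ →ₐ[ℂ] K := MonoidAlgebra.lift ℂ K Γ ⟨⟨U, hone⟩, hmul⟩
  have hφ : ∀ g, φ (MonoidAlgebra.single g 1) = U g := fun g => by simp [φ]
  let γ : MonoidAlgebra ℂ Γ →ₐc[ℂ] K := BialgHom.ofAlgHom φ
    (by ext g; simp [hφ, hcounit]) (by ext g; simp [hφ, hcomul])
  have hγ : ∀ x, γ x = φ x := fun _ => rfl
  refine ⟨γ, ⟨fun x => ?_, fun x => ?_⟩, fun γ' hγ' => ?_⟩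
  · induction x using MonoidAlgebra.induction_linear with
    | zero => simp
    | add x y hx hy => rw [star_add, map_add, map_add, hx, hy, star_add]
    | single g c =>
      rw [single_eq_smul, star_smul, map_smul, map_smul, star_smul, star_single, star_one,
        hγ, hγ, hφ, hφ, hstar]
  · induction x using MonoidAlgebra.induction_linear with
    | zero => simp
    | add x y hx hy => rw [map_add, map_add, hx, hy, map_add]
    | single g c =>
      rw [single_eq_smul, map_smul, map_smul, map_smul, comulAction_hom_single, hU,
        TensorProduct.map_tmul]
      congr 2
      exact hφ g
  · apply BialgHom.coe_linearMap_injective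
    refine linearMap_ext fun g => single_tmul_injective g ?_
    have h1 := hγ'.2 (MonoidAlgebra.single g 1)
    rw [comulAction_hom_single, hU, TensorProduct.map_tmul] at h1
    refine h1.trans ?_
    congr 1
    exact (hφ g).symm

end UniqueMorphism

/-! ### Convolution operators as Fourier multipliers. -/

variable [Fintype Γ]

lemma psi_eq (x : MonoidAlgebra ℂ Γ) :
    FiniteQuantumSet.psi x = Fintype.card Γ * x.coeff 1 := rfl

lemma card_ne_zero : (Fintype.card Γ : ℂ) ≠ 0 := by simp

/-- Expresses the Fourier transform through `ψ`, so that separating its values becomes the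
non-vanishing of `ψ (P * a)`. -/
lemma coeff_mul_single_inv (P : MonoidAlgebra ℂ Γ) (g : Γ) :
    (P * MonoidAlgebra.single g⁻¹ 1).coeff 1 = P.coeff g := by
  classical
  rw [coeff_mul_one]
  simp [Finsupp.single_apply]

/-- The convolution operator of `P` is diagonal, with the Fourier transform of `P` as symbol. -/
lemma cayleyAdjacency_single (P : MonoidAlgebra ℂ Γ) (g : Γ) (c : ℂ) :
    cayleyAdjacency P (MonoidAlgebra.single g c)
      = (Fintype.card Γ * P.coeff g) • MonoidAlgebra.single g c := by
  have key : FiniteQuantumSet.psi (HopfAlgebra.antipode ℂ P * MonoidAlgebra.single g (1 : ℂ))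
      = Fintype.card Γ * P.coeff g := by
    rw [psi_eq]
    congr 1
    induction P using MonoidAlgebra.induction_linear with
    | zero => simp
    | add x y hx hy => simp [add_mul, hx, hy]
    | single h d =>
      classical
      simp [MonoidAlgebra.single_mul_single, Finsupp.single_apply, inv_mul_eq_one]
  rw [← key, single_eq_smul, map_smul, smul_comm]
  congr 1
  simp [cayleyAdjacency, convLeft, psiAt]

lemma coeff_cayleyAdjacency (P x : MonoidAlgebra ℂ Γ) (g : Γ) :
    (cayleyAdjacency P x).coeff g = Fintype.card Γ * P.coeff g * x.coeff g := by
  classical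
  induction x using MonoidAlgebra.induction_linear with
  | zero => simp
  | add x y hx hy => simp [hx, hy, mul_add]
  | single h c =>
    rw [cayleyAdjacency_single]
    by_cases hg : h = g
    · simp [hg]
    · simp [hg]

lemma coeff_mul (x y : MonoidAlgebra ℂ Γ) (g : Γ) :
    (x * y).coeff g = ∑ h : Γ, x.coeff h * y.coeff (h⁻¹ * g) := by
  classical
  induction x using MonoidAlgebra.induction_linear with
  | zero => simp
  | add x x' hx hx' => simp [add_mul, hx, hx', Finset.sum_add_distrib]
  | single a c =>
    simp [MonoidAlgebra.coeff_single_mul_apply, Finsupp.single_apply]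

/-- The Cayley graph of an orthogonal projection is a quantum graph. -/
lemma isQuantumGraph_cayleyAdjacency {P : MonoidAlgebra ℂ Γ} (hP : IsStarProjection P) :
    IsQuantumGraph (cayleyAdjacency P) := by
  refine ⟨linearMap_ext fun g => ?_, fun f => ?_⟩
  -- The Schur square has symbol `|Γ|⁻¹ ∑ |Γ|T(h) · |Γ|T(h⁻¹g)`, which is `|Γ|` times the
  -- coefficient of `P²` at `g`.
  · have hmul := coeff_mul P P g
    rw [hP.isIdempotentElem.eq] at hmul
    have hc : (Fintype.card Γ : ℂ) ≠ 0 := card_ne_zero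
    change LinearMap.mul' ℂ _ (TensorProduct.map _ _ (mulAdjoint Γ _)) = _
    rw [mulAdjoint_single, cayleyAdjacency_single, hmul]
    simp only [map_smul, map_sum, TensorProduct.map_tmul, cayleyAdjacency_single,
      LinearMap.mul'_apply, smul_mul_assoc, mul_smul_comm, MonoidAlgebra.single_mul_single,
      mul_inv_cancel_left, one_mul, smul_smul, ← Finset.sum_smul]
    congr 1
    rw [Finset.mul_sum, Finset.mul_sum]
    refine Finset.sum_congr rfl fun h _ => ?_
    field_simp
  · apply MonoidAlgebra.coeff_injective
    ext g
    have hg : star (P.coeff g⁻¹) = P.coeff g := by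
      rw [← coeff_star, hP.isSelfAdjoint.star_eq]
    rw [coeff_star, coeff_cayleyAdjacency, coeff_cayleyAdjacency, coeff_star, inv_inv]
    simp only [star_mul', star_star, hg]
    simp

lemma isGraphAction_comulAction (P : MonoidAlgebra ℂ Γ) :
    (comulAction (MonoidAlgebra ℂ Γ)).IsGraphAction (cayleyAdjacency P) where
  preserves_psi x := by
    classical
    unfold QuantumAction.slice
    induction x using MonoidAlgebra.induction_linear with
    | zero => simp
    | add x y hx hy => rw [map_add, map_add, map_add, hx, hy, map_add, map_add]
    | single g c =>
      rw [comulAction_hom_single]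
      by_cases hg : g = 1
      · subst hg
        simp [psi_eq, Algebra.algebraMap_eq_smul_one, MonoidAlgebra.one_def]
      · simp [psi_eq, hg]
  preserves_adjacency x := by
    induction x using MonoidAlgebra.induction_linear with
    | zero => simp
    | add x y hx hy => rw [map_add, map_add, map_add, hx, hy, map_add]
    | single g c =>
      rw [comulAction_hom_single, TensorProduct.map_tmul, cayleyAdjacency_single, map_smul,
        comulAction_hom_single, TensorProduct.smul_tmul']
      rfl

/-! ### Actions on the Cayley graph are diagonal. -/

section Universal

variable {K : Type w} [Ring K] [StarRing K] [HopfAlgebra ℂ K] [StarModule ℂ K]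
  {β : QuantumAction (MonoidAlgebra ℂ Γ) K} {P : MonoidAlgebra ℂ Γ}

/-- The slice at `h` of `(A ⊗ id) β(λ_g) = β(A λ_g)` multiplies the same element by the eigenvalue
at `h` on one side and by that at `g` on the other. -/
lemma coeffSlice_eq_zero (hβ : β.IsGraphAction (cayleyAdjacency P)) {g h : Γ}
    (hgh : P.coeff h ≠ P.coeff g) : coeffSlice K h (β.hom (MonoidAlgebra.single g 1)) = 0 := by
  have hA : ∀ x : MonoidAlgebra ℂ Γ ⊗[ℂ] K, coeffSlice K h
      (TensorProduct.map (cayleyAdjacency P) (LinearMap.id : K →ₗ[ℂ] K) x)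
      = (Fintype.card Γ * P.coeff h) • coeffSlice K h x := by
    intro x
    induction x using TensorProduct.induction_on with
    | zero => simp
    | add x y hx hy => simp only [map_add, hx, hy, smul_add]
    | tmul a k => simp [coeff_cayleyAdjacency, smul_smul]
  have h1 := congrArg (coeffSlice K h) (hβ.preserves_adjacency (MonoidAlgebra.single g 1))
  rw [hA, cayleyAdjacency_single, map_smul, map_smul, ← sub_eq_zero, ← sub_smul,
    smul_eq_zero, ← mul_sub] at h1
  exact h1.resolve_left (mul_ne_zero card_ne_zero (sub_ne_zero.2 hgh))

/-- An action preserving the convolution by an element whose Fourier transform separates the pairs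
that are not central is diagonal on the group elements. -/
lemma hom_single_eq (hΓ : ∃ a b : Γ, a * b ≠ b * a)
    (hT : ∀ g h : Γ, g ≠ h → (g ∉ Subgroup.center Γ ∨ h ∉ Subgroup.center Γ) →
      P.coeff g ≠ P.coeff h)
    (hβ : β.IsGraphAction (cayleyAdjacency P)) (g : Γ) :
    β.hom (MonoidAlgebra.single g 1)
      = MonoidAlgebra.single g 1 ⊗ₜ coeffSlice K g (β.hom (MonoidAlgebra.single g 1)) := by
  have noncentral : ∀ g : Γ, g ∉ Subgroup.center Γ → β.hom (MonoidAlgebra.single g 1)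
      = MonoidAlgebra.single g 1 ⊗ₜ coeffSlice K g (β.hom (MonoidAlgebra.single g 1)) := by
    intro g hg
    conv_lhs => rw [← sum_single_tmul_coeffSlice (β.hom (MonoidAlgebra.single g 1))]
    refine Finset.sum_eq_single g (fun h _ hh => ?_) (by simp)
    rw [coeffSlice_eq_zero hβ (hT h g hh (Or.inr hg)), TensorProduct.tmul_zero]
  by_cases hg : g ∈ Subgroup.center Γ
  -- Write `g = (g a) a⁻¹` with `a` non-central; both factors are then non-central.
  · obtain ⟨a, b, hab⟩ := hΓ
    have ha : a ∉ Subgroup.center Γ := fun h =>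
      hab ((Subgroup.mem_center_iff.1 h b).symm)
    have hga : g * a ∉ Subgroup.center Γ := fun h =>
      ha ((Subgroup.mul_mem_cancel_left _ hg).1 h)
    have ha' : a⁻¹ ∉ Subgroup.center Γ := fun h => ha (by simpa using h)
    have hmul : (MonoidAlgebra.single g (1 : ℂ) : MonoidAlgebra ℂ Γ)
        = MonoidAlgebra.single (g * a) 1 * MonoidAlgebra.single a⁻¹ 1 := by
      simp [MonoidAlgebra.single_mul_single]
    have hx : β.hom (MonoidAlgebra.single g 1) = MonoidAlgebra.single g (1 : ℂ) ⊗ₜ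
        (coeffSlice K (g * a) (β.hom (MonoidAlgebra.single (g * a) 1))
          * coeffSlice K a⁻¹ (β.hom (MonoidAlgebra.single a⁻¹ 1))) := by
      rw [hmul, map_mul, noncentral _ hga, noncentral _ ha',
        Algebra.TensorProduct.tmul_mul_tmul]
      simp
    rw [hx]
    simp
  · exact noncentral g hg

end Universal

/-- If the Fourier transform of `P` separates the pairs of elements that are not both central, the
dual of `Γ` is the quantum automorphism group of the quantum Cayley graph of `P`. -/
lemma isQuantumAutomorphismGroup_comulAction (hΓ : ∃ a b : Γ, a * b ≠ b * a)
    {P : MonoidAlgebra ℂ Γ}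
    (hT : ∀ g h : Γ, g ≠ h → (g ∉ Subgroup.center Γ ∨ h ∉ Subgroup.center Γ) →
      P.coeff g ≠ P.coeff h) :
    IsQuantumAutomorphismGroup.{u, u, v} (cayleyAdjacency P)
      (comulAction (MonoidAlgebra ℂ Γ)) where
  isGraphAction := isGraphAction_comulAction P
  isFaithful := isFaithful_comulAction
  universal _ _ _ _ _ _ _ hβ := existsUnique_bialgHom (hom_single_eq hΓ hT hβ)

end GroupDual

/-! ### Common non-zeros of functions that are polynomial along real lines. -/

section Genericity

/-- A complex function on a real vector space is polynomial along lines if its restriction to every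
real line is given by a complex polynomial. -/
def IsPolynomialOnLines {V : Type*} [AddCommGroup V] [Module ℝ V] (F : V → ℂ) : Prop :=
  ∀ v v' : V, ∃ p : Polynomial ℂ, ∀ s : ℝ, F (v + s • v') = p.eval (s : ℂ)

variable {V : Type*} [AddCommGroup V] [Module ℝ V]

namespace IsPolynomialOnLines

lemma mul {F G : V → ℂ} (hF : IsPolynomialOnLines F) (hG : IsPolynomialOnLines G) :
    IsPolynomialOnLines fun v => F v * G v := fun v v' => by
  obtain ⟨p, hp⟩ := hF v v'
  obtain ⟨q, hq⟩ := hG v v'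
  exact ⟨p * q, fun s => by simp [hp, hq]⟩

lemma const (c : ℂ) : IsPolynomialOnLines fun _ : V => c := fun _ _ =>
  ⟨Polynomial.C c, fun s => by simp⟩

lemma sum {ι : Type*} {s : Finset ι} {F : ι → V → ℂ}
    (hF : ∀ i ∈ s, IsPolynomialOnLines (F i)) : IsPolynomialOnLines fun v => ∑ i ∈ s, F i v := by
  intro v v'
  have : ∀ i, ∃ p : Polynomial ℂ, i ∈ s → ∀ t : ℝ, F i (v + t • v') = p.eval (t : ℂ) := by
    intro i
    by_cases hi : i ∈ s
    · obtain ⟨p, hp⟩ := hF i hi v v'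
      exact ⟨p, fun _ => hp⟩
    · exact ⟨0, fun h => absurd h hi⟩
  choose p hp using this
  refine ⟨∑ i ∈ s, p i, fun t => ?_⟩
  rw [Polynomial.eval_finsetSum]
  exact Finset.sum_congr rfl fun i hi => hp i hi t

lemma prod {ι : Type*} {s : Finset ι} {F : ι → V → ℂ}
    (hF : ∀ i ∈ s, IsPolynomialOnLines (F i)) : IsPolynomialOnLines fun v => ∏ i ∈ s, F i v := by
  classical
  induction s using Finset.induction_on with
  | empty => simpa using const (V := V) 1
  | insert a s ha ih =>
    simp only [Finset.prod_insert ha]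
    exact (hF a (by simp)).mul (ih fun i hi => hF i (by simp [hi]))

/-- A real bilinear function restricted to the diagonal is polynomial along lines. -/
lemma of_biadditive {B : V → V → ℂ} (h1 : ∀ x y z, B (x + y) z = B x z + B y z)
    (h2 : ∀ x y z, B x (y + z) = B x y + B x z) (h3 : ∀ (s : ℝ) x y, B (s • x) y = s * B x y)
    (h4 : ∀ (s : ℝ) x y, B x (s • y) = s * B x y) : IsPolynomialOnLines fun v => B v v := by
  intro v v'
  refine ⟨Polynomial.C (B v v) + Polynomial.C (B v v' + B v' v) * Polynomial.X
    + Polynomial.C (B v' v') * Polynomial.X ^ 2, fun s => ?_⟩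
  simp only [h1, h2, h3, h4, Polynomial.eval_add, Polynomial.eval_mul, Polynomial.eval_C,
    Polynomial.eval_X, Polynomial.eval_pow]
  ring

/-- On the line joining a non-zero of `F` (at `s = 0`) to one of `G` (at `s = 1`) both restrict to
non-zero polynomials, whose product cannot vanish at all real `s`. -/
lemma exists_mul_ne_zero {F G : V → ℂ} (hF : IsPolynomialOnLines F) (hG : IsPolynomialOnLines G)
    (hF0 : ∃ v, F v ≠ 0) (hG0 : ∃ v, G v ≠ 0) : ∃ v, F v * G v ≠ 0 := by
  obtain ⟨x, hx⟩ := hF0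
  obtain ⟨y, hy⟩ := hG0
  obtain ⟨p, hp⟩ := hF x (y - x)
  obtain ⟨q, hq⟩ := hG x (y - x)
  have hp0 : p ≠ 0 := by
    rintro rfl
    exact hx (by simpa using hp 0)
  have hq0 : q ≠ 0 := by
    rintro rfl
    exact hy (by simpa using hq 1)
  by_contra! h
  refine mul_ne_zero hp0 hq0 (Polynomial.eq_zero_of_infinite_isRoot _ ?_)
  refine (Set.infinite_range_of_injective Complex.ofReal_injective).mono ?_
  rintro _ ⟨s, rfl⟩
  have := h (x + s • (y - x))
  rw [hp, hq] at this
  simpa [Polynomial.IsRoot] using this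

lemma exists_prod_ne_zero {ι : Type*} {s : Finset ι} {F : ι → V → ℂ}
    (hF : ∀ i ∈ s, IsPolynomialOnLines (F i)) (h0 : ∀ i ∈ s, ∃ v, F i v ≠ 0) :
    ∃ v, ∏ i ∈ s, F i v ≠ 0 := by
  classical
  induction s using Finset.induction_on with
  | empty => exact ⟨0, by simp⟩
  | insert a s ha ih =>
    simp only [Finset.prod_insert ha]
    exact (hF a (by simp)).exists_mul_ne_zero (prod fun i hi => hF i (by simp [hi]))
      (h0 a (by simp)) (ih (fun i hi => hF i (by simp [hi])) fun i hi => h0 i (by simp [hi]))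

end IsPolynomialOnLines

variable {n : Type*} [Fintype n]

/-- If `v · a Y(v) = c (v · Y(v))` for all `v`, with `Y` conjugate linear and `v · Y(v) ≠ 0` for
`v ≠ 0`, then the matrix `a` is the scalar `c`. -/
lemma eq_scalar_of_dotProduct_eq [DecidableEq n] {Y : (n → ℂ) →ₗ[ℝ] (n → ℂ)}
    (hY : ∀ v, Y (Complex.I • v) = -Complex.I • Y v) (hne : ∀ v, v ≠ 0 → v ⬝ᵥ Y v ≠ 0)
    {a : Matrix n n ℂ} {c : ℂ} (h : ∀ v, v ⬝ᵥ a.mulVec (Y v) = c * (v ⬝ᵥ Y v)) :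
    a = Matrix.scalar n c := by
  have hinj : Function.Injective Y := by
    rw [injective_iff_map_eq_zero]
    intro v hv
    by_contra h0
    exact hne v h0 (by simp [hv])
  have hsurj : Function.Surjective Y := LinearMap.injective_iff_surjective.1 hinj
  set b : Matrix n n ℂ := a - Matrix.scalar n c with hb
  have hbv : ∀ x, b.mulVec x = a.mulVec x - c • x := fun x => by
    simp [hb, Matrix.sub_mulVec, ← Matrix.smul_one_eq_diagonal, Matrix.smul_mulVec]
  have h0 : ∀ v, v ⬝ᵥ b.mulVec (Y v) = 0 := fun v => by
    rw [hbv, dotProduct_sub, h, dotProduct_smul, smul_eq_mul, sub_self]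
  -- Polarisation: replacing `x` by `I • x` multiplies one cross term by `-I` and the other by `I`,
  -- so each vanishes separately.
  have h1 : ∀ v x, v ⬝ᵥ b.mulVec (Y x) = 0 := by
    intro v x
    have e1 := h0 (v + x)
    have e2 := h0 (v + Complex.I • x)
    simp only [map_add, Matrix.mulVec_add, add_dotProduct, dotProduct_add, h0, hY,
      Matrix.mulVec_smul, smul_dotProduct, dotProduct_smul, smul_eq_mul] at e1 e2
    have hI := Complex.I_mul_I
    linear_combination (1 / 2) * e1 + (Complex.I / 2) * e2
      + ((v ⬝ᵥ b.mulVec (Y x)) / 2 - (x ⬝ᵥ b.mulVec (Y v)) / 2) * hI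
  have h2 : b = 0 := by
    ext i j
    obtain ⟨x, hx⟩ := hsurj (Pi.single j 1)
    have := h1 (Pi.single i 1) x
    rw [hx] at this
    simpa using this
  exact sub_eq_zero.1 h2

/-- A common point at which finitely many sums of Rayleigh quotients do not vanish, if each of them
involves a matrix that is not a scalar. -/
theorem exists_sum_div_ne_zero {ι J : Type*} [Fintype J] [DecidableEq ι] (S : Finset ι)
    {d : ι → ℕ} (hd : ∀ i, d i ≠ 0)
    (Y : ∀ i, (Fin (d i) → ℂ) →ₗ[ℝ] (Fin (d i) → ℂ))
    (hY : ∀ i v, Y i (Complex.I • v) = -Complex.I • Y i v)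
    (hne : ∀ i v, v ≠ 0 → v ⬝ᵥ Y i v ≠ 0)
    (κ : ι → ℂ) (hκ : ∀ i, κ i ≠ 0)
    (a : J → ∀ i, Matrix (Fin (d i)) (Fin (d i)) ℂ)
    (ha : ∀ j, ∃ i ∈ S, ∀ c, a j i ≠ Matrix.scalar _ c) :
    ∃ w : ∀ i, Fin (d i) → ℂ, (∀ i ∈ S, w i ≠ 0) ∧
      ∀ j, ∑ i ∈ S, κ i * (w i ⬝ᵥ (a j i).mulVec (Y i (w i))) / (w i ⬝ᵥ Y i (w i)) ≠ 0 := by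
  let t : ι → (∀ i, Fin (d i) → ℂ) → ℂ := fun i w => w i ⬝ᵥ Y i (w i)
  let r : J → ι → (∀ i, Fin (d i) → ℂ) → ℂ := fun j i w => w i ⬝ᵥ (a j i).mulVec (Y i (w i))
  -- The sum of quotients multiplied by all the denominators `t i`.
  let G : J → (∀ i, Fin (d i) → ℂ) → ℂ := fun j w =>
    ∑ i ∈ S, κ i * r j i w * ∏ k ∈ S.erase i, t k w
  have hsmulv : ∀ (s : ℝ) {m : ℕ} (x : Fin m → ℂ), s • x = (s : ℂ) • x := fun s m x => by
    ext; simp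
  have ht : ∀ i, IsPolynomialOnLines (t i) := fun i =>
    IsPolynomialOnLines.of_biadditive (B := fun w w' : ∀ i, Fin (d i) → ℂ => w i ⬝ᵥ Y i (w' i))
      (fun x y z => by simp [add_dotProduct]) (fun x y z => by simp [dotProduct_add])
      (fun s x y => by rw [Pi.smul_apply, hsmulv, smul_dotProduct, smul_eq_mul])
      (fun s x y => by rw [Pi.smul_apply, map_smul, hsmulv, dotProduct_smul, smul_eq_mul])
  have hr : ∀ j i, IsPolynomialOnLines (r j i) := fun j i =>
    IsPolynomialOnLines.of_biadditive
      (B := fun w w' : ∀ i, Fin (d i) → ℂ => w i ⬝ᵥ (a j i).mulVec (Y i (w' i)))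
      (fun x y z => by simp [add_dotProduct])
      (fun x y z => by simp [dotProduct_add, Matrix.mulVec_add])
      (fun s x y => by rw [Pi.smul_apply, hsmulv, smul_dotProduct, smul_eq_mul])
      (fun s x y => by
        rw [Pi.smul_apply, map_smul, hsmulv, Matrix.mulVec_smul, dotProduct_smul, smul_eq_mul])
  have hG : ∀ j, IsPolynomialOnLines (G j) := fun j => .sum fun i _ =>
    ((IsPolynomialOnLines.const _).mul (hr j i)).mul (.prod fun k _ => ht k)
  have hGt : ∀ j w, (∀ i ∈ S, t i w ≠ 0) →
      G j w = (∑ i ∈ S, κ i * r j i w / t i w) * ∏ i ∈ S, t i w := by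
    intro j w hw
    rw [Finset.sum_mul]
    refine Finset.sum_congr rfl fun i hi => ?_
    rw [← Finset.mul_prod_erase S _ hi]
    field_simp [hw i hi]
  have hone : ∀ i, (1 : Fin (d i) → ℂ) ≠ 0 := fun i h => by
    have : NeZero (d i) := ⟨hd i⟩
    simpa using congrFun h 0
  have hG0 : ∀ j, ∃ w, G j w ≠ 0 := by
    intro j
    obtain ⟨i, hi, hsc⟩ := ha j
    by_contra! h
    let w : (Fin (d i) → ℂ) → ∀ i, Fin (d i) → ℂ := fun v => Function.update (fun _ => 1) i v
    have hwi : ∀ v, w v i = v := fun v => by simp [w]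
    have hwk : ∀ v k, k ≠ i → w v k = 1 := fun v k hk => by simp [w, hk]
    -- Only block `i` varies with `v`, so the other terms add up to a constant; the argument `0` is
    -- arbitrary. If `G j` vanished, the Rayleigh quotient in block `i` would be constantly `-C / κ
    -- i`.
    let C : ℂ := ∑ k ∈ S.erase i, κ k * r j k (w 0) / t k (w 0)
    refine hsc (-C / κ i) (eq_scalar_of_dotProduct_eq (hY i) (hne i) fun v => ?_)
    by_cases hv : v = 0
    · simp [hv]
    have hw : ∀ k, t k (w v) ≠ 0 := fun k => hne k _ <| by
      by_cases hk : k = i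
      · subst hk; rwa [hwi]
      · rw [hwk v k hk]; exact hone k
    have h1 := h (w v)
    rw [hGt j _ fun k _ => hw k, mul_eq_zero,
      or_iff_left (Finset.prod_ne_zero_iff.2 fun k _ => hw k), ← Finset.add_sum_erase S _ hi] at h1
    have h2 : ∑ k ∈ S.erase i, κ k * r j k (w v) / t k (w v) = C :=
      Finset.sum_congr rfl fun k hk => by
        have hk' := Finset.ne_of_mem_erase hk
        simp only [r, t, hwk _ k hk']
    rw [h2] at h1
    have h3 : t i (w v) = v ⬝ᵥ Y i v := by simp only [t, hwi]
    have h4 : r j i (w v) = v ⬝ᵥ (a j i).mulVec (Y i v) := by simp only [r, hwi]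
    rw [← h3, ← h4]
    have h5 := hw i
    have h6 := hκ i
    field_simp at h1 ⊢
    linear_combination h1
  obtain ⟨w, hw⟩ := IsPolynomialOnLines.exists_mul_ne_zero
    (IsPolynomialOnLines.prod fun i (_ : i ∈ S) => ht i)
    (IsPolynomialOnLines.prod fun j (_ : j ∈ (Finset.univ : Finset J)) => hG j)
    ⟨1, Finset.prod_ne_zero_iff.2 fun i _ => hne i _ (hone i)⟩
    (IsPolynomialOnLines.exists_prod_ne_zero (fun j _ => hG j) fun j _ => hG0 j)
  have hwt := Finset.prod_ne_zero_iff.1 (left_ne_zero_of_mul hw)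
  have hwG := Finset.prod_ne_zero_iff.1 (right_ne_zero_of_mul hw)
  refine ⟨w, fun i hi h => hwt i hi (by simp [t, h]), fun j h => ?_⟩
  refine hwG j (Finset.mem_univ j) ?_
  rw [hGt j w hwt]
  exact mul_eq_zero_of_left h _

end Genericity

/-! ### Blocks of a multimatrix algebra. -/

section Blocks

open Matrix

variable {A : Type*} [Ring A] [Algebra ℂ A] {ι : Type*} {d : ι → ℕ}
  (φ : A ≃ₐ[ℂ] ∀ i, Matrix (Fin (d i)) (Fin (d i)) ℂ)

lemma exists_ne_scalar_of_not_commute {a : A} (ha : ∃ x, a * x ≠ x * a) :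
    ∃ i, ∀ c, φ a i ≠ scalar _ c := by
  by_contra! h
  obtain ⟨x, hx⟩ := ha
  refine hx (φ.injective ?_)
  rw [map_mul, map_mul]
  ext1 i
  obtain ⟨c, hc⟩ := h i
  rw [Pi.mul_apply, Pi.mul_apply, hc]
  exact scalar_commute c (Commute.all c) _

variable [DecidableEq ι]

/-- The element of a multimatrix algebra with a given block and zeros elsewhere. -/
noncomputable def blockElem (i : ι) : Matrix (Fin (d i)) (Fin (d i)) ℂ →ₗ[ℂ] A :=
  φ.symm.toLinearMap ∘ₗ LinearMap.single ℂ (fun j => Matrix (Fin (d j)) (Fin (d j)) ℂ) i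

lemma map_blockElem (i : ι) (M : Matrix (Fin (d i)) (Fin (d i)) ℂ) :
    φ (blockElem φ i M) = Pi.single i M := by
  simp [blockElem]

lemma mul_blockElem (x : A) (i : ι) (M : Matrix (Fin (d i)) (Fin (d i)) ℂ) :
    x * blockElem φ i M = blockElem φ i (φ x i * M) := by
  apply φ.injective
  rw [map_mul, map_blockElem, map_blockElem]
  ext1 k
  by_cases hk : k = i
  · subst hk; simp
  · simp [hk]

lemma blockElem_mul (x : A) (i : ι) (M : Matrix (Fin (d i)) (Fin (d i)) ℂ) :
    blockElem φ i M * x = blockElem φ i (M * φ x i) := by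
  apply φ.injective
  rw [map_mul, map_blockElem, map_blockElem]
  ext1 k
  by_cases hk : k = i
  · subst hk; simp
  · simp [hk]

lemma blockElem_mul_blockElem (i : ι) (M N : Matrix (Fin (d i)) (Fin (d i)) ℂ) :
    blockElem φ i M * blockElem φ i N = blockElem φ i (M * N) := by
  rw [mul_blockElem, map_blockElem, Pi.single_eq_same]

lemma blockElem_mul_blockElem_of_ne {i j : ι} (h : i ≠ j) (M : Matrix (Fin (d i)) (Fin (d i)) ℂ)
    (N : Matrix (Fin (d j)) (Fin (d j)) ℂ) : blockElem φ i M * blockElem φ j N = 0 := by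
  rw [mul_blockElem, map_blockElem, Pi.single_eq_of_ne h.symm, zero_mul, map_zero]

lemma blockElem_injective (i : ι) : Function.Injective (blockElem φ i) := fun M N h => by
  have := congrArg φ h
  rw [map_blockElem, map_blockElem] at this
  exact Pi.single_injective i this

lemma sum_blockElem_one [Fintype ι] : ∑ i, blockElem φ i 1 = 1 := by
  apply φ.injective
  rw [map_sum, map_one]
  simp only [map_blockElem]
  exact Finset.univ_sum_single (fun i => (1 : Matrix (Fin (d i)) (Fin (d i)) ℂ))

/-! ### Ranks in irreducible representations. -/

section Rank

variable [Fintype ι] {V : Type*} [AddCommGroup V] [Module ℂ V] (π : A →ₐ[ℂ] Module.End ℂ V)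

/-- In an irreducible representation, exactly one block acts, and the others vanish. -/
lemma exists_block_of_irreducible [Nontrivial V]
    (hπ : ∀ v : V, v ≠ 0 → ∀ x, ∃ a, π a v = x) :
    ∃ i, ∀ a, π a = π (blockElem φ i (φ a i)) := by
  obtain ⟨i, hi⟩ : ∃ i, π (blockElem φ i 1) ≠ 0 := by
    by_contra! h
    have h1 : π 1 = 0 := by
      rw [← sum_blockElem_one φ, map_sum]
      exact Finset.sum_eq_zero fun i _ => h i
    rw [map_one] at h1
    exact one_ne_zero h1
  refine ⟨i, fun a => ?_⟩
  have hcomm : ∀ a, blockElem φ i 1 * a = a * blockElem φ i 1 := fun a => by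
    rw [mul_blockElem, blockElem_mul, one_mul, mul_one]
  obtain ⟨v, hv⟩ : ∃ v, π (blockElem φ i 1) v ≠ 0 := by
    by_contra! h
    exact hi (LinearMap.ext h)
  -- The block unit `e` is a central idempotent and `e v ≠ 0` is cyclic, so `e (b e v) = b e v` for
  -- all `b` shows that `e` acts as the identity.
  have hone : π (blockElem φ i 1) = 1 := by
    ext x
    obtain ⟨b, rfl⟩ := hπ _ hv x
    rw [← Module.End.mul_apply, ← Module.End.mul_apply, ← map_mul, ← map_mul, hcomm,
      mul_assoc, blockElem_mul_blockElem, one_mul, map_mul]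
    rfl
  rw [← one_mul (φ a i), ← blockElem_mul, map_mul, hone, one_mul]

/-- An element of a multimatrix algebra that is a rank one idempotent in the blocks of size greater
than one and vanishes in the others has rank one in each irreducible representation of dimension
greater than one, and acts as zero in the others. -/
theorem finrank_range_of_irreducible [∀ i, NeZero (d i)] [Nontrivial V] [Module.Finite ℂ V]
    (hπ : ∀ v : V, v ≠ 0 → ∀ x, ∃ a, π a v = x) {P : A} {y w : ∀ i, Fin (d i) → ℂ}
    (hP1 : ∀ i, 1 < d i → φ P i = vecMulVec (y i) (w i) ∧ w i ⬝ᵥ y i = 1)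
    (hP0 : ∀ i, ¬ 1 < d i → φ P i = 0) :
    Module.finrank ℂ (LinearMap.range (π P)) = if 1 < Module.finrank ℂ V then 1 else 0 := by
  obtain ⟨i, hi⟩ := exists_block_of_irreducible φ π hπ
  obtain ⟨v₀, hv₀⟩ := exists_ne (0 : V)
  have hone : π (blockElem φ i 1) = 1 := by
    have h1 := hi 1
    rwa [map_one π, map_one φ, Pi.one_apply, eq_comm] at h1
  by_cases hd : 1 < d i
  · obtain ⟨hPi, hwy⟩ := hP1 i hd
    let σ : Matrix (Fin (d i)) (Fin (d i)) ℂ → Module.End ℂ V := fun M => π (blockElem φ i M)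
    have hσ : ∀ M N, σ (M * N) = σ M * σ N := fun M N => by
      simp only [σ, ← blockElem_mul_blockElem, map_mul]
    have hσP : π P = σ (vecMulVec (y i) (w i)) := by rw [hi P, hPi]
    -- Every rank-one matrix factors through the block of `P`, so `π P = 0` would kill the whole
    -- block and its unit.
    have hfac : ∀ u v : Fin (d i) → ℂ, vecMulVec u v
        = vecMulVec u (w i) * vecMulVec (y i) (w i) * vecMulVec (y i) v := fun u v => by
      simp [vecMulVec_mul_vecMulVec, hwy]
    have hsum : (1 : Matrix (Fin (d i)) (Fin (d i)) ℂ)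
        = ∑ j, vecMulVec (Pi.single j 1) (Pi.single j 1) := by
      ext a b
      simp [Matrix.sum_apply, vecMulVec_apply, Matrix.one_apply, Pi.single_apply]
    have hQ : π P ≠ 0 := by
      intro h0
      have h1 : σ 1 = 0 := by
        have : σ 1 = ∑ j, σ (vecMulVec (Pi.single j 1) (Pi.single j 1)) := by
          simp only [σ]
          rw [hsum, map_sum, map_sum]
        rw [this]
        refine Finset.sum_eq_zero fun j _ => ?_
        rw [hfac, hσ, hσ, ← hσP, h0, mul_zero, zero_mul]
      rw [show σ 1 = 1 from hone] at h1
      exact one_ne_zero h1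
    obtain ⟨v, hv⟩ : ∃ v, π P v ≠ 0 := by
      by_contra! h
      exact hQ (LinearMap.ext h)
    -- Every vector is `a (P v)`, and `P a P` is a scalar multiple of `P`.
    have hrange : LinearMap.range (π P) = Submodule.span ℂ {π P v} := by
      apply le_antisymm
      · rintro _ ⟨x, rfl⟩
        obtain ⟨a, rfl⟩ := hπ _ hv x
        rw [Submodule.mem_span_singleton]
        refine ⟨w i ⬝ᵥ (φ a i).mulVec (y i), ?_⟩
        have : π P * (π a * π P) = (w i ⬝ᵥ (φ a i).mulVec (y i)) • π P := by
          rw [← map_mul, ← map_mul, hi (P * (a * P)), hi P, ← map_smul, ← map_smul]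
          simp only [map_mul, Pi.mul_apply, hPi]
          rw [mul_vecMulVec, vecMulVec_mul_vecMulVec, vecMulVec_smul]
        exact (LinearMap.congr_fun this v).symm
      · rw [Submodule.span_singleton_le_iff_mem]
        exact ⟨v, rfl⟩
    -- In dimension at most one, `End V` has no zero divisors, but two orthogonal diagonal matrix
    -- units of the block act by non-zero operators.
    have hdim : 1 < Module.finrank ℂ V := by
      by_contra hn
      obtain ⟨u, hu⟩ := finrank_le_one_iff.1 (not_lt.1 hn)
      have hzero : ∀ f g : Module.End ℂ V, f * g = 0 → f = 0 ∨ g = 0 := by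
        intro f g hfg
        obtain ⟨c, hc⟩ := hu (g u)
        have h1 : c • f u = 0 := by
          rw [← map_smul, hc]; exact LinearMap.congr_fun hfg u
        have hext : ∀ f : Module.End ℂ V, f u = 0 → f = 0 := fun f hf => LinearMap.ext fun x => by
          obtain ⟨b, rfl⟩ := hu x
          simp [hf]
        rcases smul_eq_zero.1 h1 with h | h
        · right
          exact hext g (by rw [← hc, h, zero_smul])
        · left
          exact hext f h
      have hE : ∀ j, σ (vecMulVec (Pi.single j 1) (Pi.single j 1)) ≠ 0 := by
        intro j h0
        apply hQ
        have : vecMulVec (y i) (w i) = vecMulVec (y i) (Pi.single j 1)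
            * vecMulVec (Pi.single j 1) (Pi.single j 1) * vecMulVec (Pi.single j 1) (w i) := by
          simp [vecMulVec_mul_vecMulVec]
        rw [hσP, this, hσ, hσ, h0, mul_zero, zero_mul]
      rcases hzero (σ (vecMulVec (Pi.single ⟨0, by omega⟩ 1) (Pi.single ⟨0, by omega⟩ 1)))
        (σ (vecMulVec (Pi.single ⟨1, hd⟩ 1) (Pi.single ⟨1, hd⟩ 1)))
        (by rw [← hσ]; simp [vecMulVec_mul_vecMulVec, σ]) with h | h
      · exact hE _ h
      · exact hE _ h
    rw [hrange, finrank_span_singleton hv, if_pos hdim]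
  · have hdi : d i = 1 := by
      have := NeZero.ne (d i)
      omega
    have hsub : Subsingleton (Fin (d i)) := by rw [hdi]; infer_instance
    have hdim : ¬ 1 < Module.finrank ℂ V := by
      rw [not_lt]
      refine finrank_le_one v₀ fun x => ?_
      obtain ⟨a, rfl⟩ := hπ v₀ hv₀ x
      refine ⟨φ a i 0 0, ?_⟩
      have h1 : φ a i = φ a i 0 0 • 1 := by
        ext b c
        simp [Subsingleton.elim b 0, Subsingleton.elim c 0]
      have h2 : π a = φ a i 0 0 • (1 : Module.End ℂ V) := by
        rw [hi a, h1, map_smul, map_smul, hone]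
        simp
      rw [h2]; rfl
    rw [if_neg hdim, hi P, hP0 i hd, map_zero, map_zero, LinearMap.range_zero, finrank_bot]

end Rank

end Blocks

/-! ### Rank-one orthogonal projections in the blocks. -/

section MinimalProjections

open Matrix

variable {A : Type*} [Ring A] [StarRing A] [Algebra ℂ A] [StarModule ℂ A]
  {ι : Type*} [DecidableEq ι] {d : ι → ℕ} [∀ i, NeZero (d i)]
  (φ : A ≃ₐ[ℂ] ∀ i, Matrix (Fin (d i)) (Fin (d i)) ℂ)

/-- The matrix with first row `w` in the block `i`. -/
noncomputable def rowElem (i : ι) (w : Fin (d i) → ℂ) : A :=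
  blockElem φ i (vecMulVec (Pi.single 0 1) w)

/-- The conjugate linear map `w ↦ y` with `N* N = y wᵀ`, for the matrix `N` with first row `w` in
the block `i`. -/
noncomputable def conjCol (i : ι) : (Fin (d i) → ℂ) →ₗ[ℝ] (Fin (d i) → ℂ) where
  toFun w := (φ (star (rowElem φ i w)) i).mulVec (Pi.single 0 1)
  map_add' v w := by
    simp only [rowElem, vecMulVec_add, map_add, star_add, Pi.add_apply, add_mulVec]
  map_smul' s w := by
    have hs : s • w = (s : ℂ) • w := by ext; simp
    rw [hs, rowElem, vecMulVec_smul, map_smul, star_smul, map_smul, Pi.smul_apply, smul_mulVec]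
    ext
    simp [rowElem]

lemma conjCol_I_smul (i : ι) (w : Fin (d i) → ℂ) :
    conjCol φ i (Complex.I • w) = -Complex.I • conjCol φ i w := by
  change (φ (star (rowElem φ i (Complex.I • w))) i).mulVec _ = _
  rw [rowElem, vecMulVec_smul, map_smul, star_smul, map_smul, Pi.smul_apply, smul_mulVec]
  simp [conjCol, rowElem]

lemma star_rowElem_mul_rowElem (i : ι) (w : Fin (d i) → ℂ) :
    star (rowElem φ i w) * rowElem φ i w = blockElem φ i (vecMulVec (conjCol φ i w) w) := by
  conv_lhs => rw [rowElem, mul_blockElem, mul_vecMulVec]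
  rfl

lemma star_blockElem_conjCol (i : ι) (w : Fin (d i) → ℂ) :
    star (blockElem φ i (vecMulVec (conjCol φ i w) w))
      = blockElem φ i (vecMulVec (conjCol φ i w) w) := by
  rw [← star_rowElem_mul_rowElem, star_mul, star_star]

lemma blockElem_conjCol_mul_self (i : ι) (w : Fin (d i) → ℂ) :
    blockElem φ i (vecMulVec (conjCol φ i w) w) * blockElem φ i (vecMulVec (conjCol φ i w) w)
      = (w ⬝ᵥ conjCol φ i w) • blockElem φ i (vecMulVec (conjCol φ i w) w) := by
  rw [blockElem_mul_blockElem, vecMulVec_mul_vecMulVec, vecMulVec_smul, map_smul]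

/-- The orthogonal projection of rank one onto the line of `conjCol φ i w` in the block `i`. -/
noncomputable def minProj (i : ι) (w : Fin (d i) → ℂ) : A :=
  (w ⬝ᵥ conjCol φ i w)⁻¹ • blockElem φ i (vecMulVec (conjCol φ i w) w)

lemma minProj_eq (i : ι) (w : Fin (d i) → ℂ) : minProj φ i w
    = blockElem φ i (vecMulVec ((w ⬝ᵥ conjCol φ i w)⁻¹ • conjCol φ i w) w) := by
  rw [minProj, ← map_smul, smul_vecMulVec]

lemma minProj_mul_minProj_of_ne {i j : ι} (h : i ≠ j) (v : Fin (d i) → ℂ) (w : Fin (d j) → ℂ) :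
    minProj φ i v * minProj φ j w = 0 := by
  rw [minProj_eq, minProj_eq, blockElem_mul_blockElem_of_ne φ h]

lemma map_sum_minProj (S : Finset ι) (w : ∀ i, Fin (d i) → ℂ) (i : ι) :
    φ (∑ k ∈ S, minProj φ k (w k)) i = if i ∈ S then
      vecMulVec ((w i ⬝ᵥ conjCol φ i (w i))⁻¹ • conjCol φ i (w i)) (w i) else 0 := by
  rw [map_sum, Finset.sum_apply]
  simp only [minProj_eq, map_blockElem]
  split_ifs with hi
  · rw [Finset.sum_eq_single i (fun k _ hk => Pi.single_eq_of_ne hk.symm _)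
      (fun h => absurd hi h), Pi.single_eq_same]
  · refine Finset.sum_eq_zero fun k hk => Pi.single_eq_of_ne ?_ _
    rintro rfl
    exact hi hk

variable [FiniteQuantumSet A]

lemma psi_blockElem_conjCol_ne_zero {i : ι} {w : Fin (d i) → ℂ} (hw : w ≠ 0) :
    FiniteQuantumSet.psi (blockElem φ i (vecMulVec (conjCol φ i w) w)) ≠ 0 := by
  rw [← star_rowElem_mul_rowElem]
  intro h
  have h1 := FiniteQuantumSet.psi_faithful _ h
  rw [rowElem, ← map_zero (blockElem φ i)] at h1
  have h2 := blockElem_injective φ i h1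
  apply hw
  ext j
  simpa [vecMulVec_apply] using congrFun (congrFun h2 0) j

/-- With `Q = N* N` self-adjoint and `Q² = t Q`, the value `t = 0` would give `Q* Q = 0`, hence `Q =
0`, against faithfulness of `ψ`. -/
lemma dotProduct_conjCol_ne_zero (i : ι) (w : Fin (d i) → ℂ) (hw : w ≠ 0) :
    w ⬝ᵥ conjCol φ i w ≠ 0 := by
  intro h
  have h1 := blockElem_conjCol_mul_self φ i w
  rw [h, zero_smul] at h1
  nth_rw 1 [← star_blockElem_conjCol] at h1
  have h2 := FiniteQuantumSet.psi_faithful _ ((congrArg _ h1).trans (map_zero _))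
  exact psi_blockElem_conjCol_ne_zero φ hw (by rw [h2, map_zero])

lemma isStarProjection_minProj (i : ι) {w : Fin (d i) → ℂ} (hw : w ≠ 0) :
    IsStarProjection (minProj φ i w) := by
  have ht := dotProduct_conjCol_ne_zero φ i w hw
  have hq : blockElem φ i (vecMulVec (conjCol φ i w) w) ≠ 0 := fun h =>
    psi_blockElem_conjCol_ne_zero φ hw (by rw [h, map_zero])
  have hmul := blockElem_conjCol_mul_self φ i w
  have hstar := star_blockElem_conjCol φ i w
  -- Take adjoints in `Q² = t Q`, where `Q` is self-adjoint and non-zero.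
  have hreal : star (w ⬝ᵥ conjCol φ i w) = w ⬝ᵥ conjCol φ i w := by
    have h1 := congrArg star hmul
    rw [star_mul, hstar, star_smul, hstar, hmul] at h1
    exact (smul_left_injective ℂ hq h1).symm
  refine ⟨?_, ?_⟩
  · rw [IsIdempotentElem, minProj, smul_mul_smul_comm, hmul, smul_smul]
    congr 1
    field_simp
  · rw [IsSelfAdjoint, minProj, star_smul, hstar, star_inv₀, hreal]

lemma isStarProjection_sum_minProj (S : Finset ι) {w : ∀ i, Fin (d i) → ℂ}
    (hw : ∀ i ∈ S, w i ≠ 0) : IsStarProjection (∑ i ∈ S, minProj φ i (w i)) := by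
  refine ⟨?_, ?_⟩
  · rw [IsIdempotentElem, Finset.sum_mul_sum]
    refine Finset.sum_congr rfl fun i hi => ?_
    rw [Finset.sum_eq_single i (fun j _ hj => minProj_mul_minProj_of_ne φ hj.symm _ _)
      (fun h => absurd hi h)]
    exact (isStarProjection_minProj φ i (hw i hi)).isIdempotentElem
  · rw [IsSelfAdjoint, star_sum]
    exact Finset.sum_congr rfl fun i hi =>
      (isStarProjection_minProj φ i (hw i hi)).isSelfAdjoint

/-- The value of the trace at the matrix units on the diagonal of a block. -/
noncomputable def blockTrace (i : ι) : ℂ :=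
  FiniteQuantumSet.psi (blockElem φ i (vecMulVec (Pi.single 0 1) (Pi.single 0 1)))

/-- Traciality moves `u` past `v` after factoring through the first basis vector. -/
lemma psi_blockElem_vecMulVec (i : ι) (u v : Fin (d i) → ℂ) :
    FiniteQuantumSet.psi (blockElem φ i (vecMulVec u v)) = blockTrace φ i * (v ⬝ᵥ u) := by
  have h : vecMulVec u v = vecMulVec u (Pi.single 0 1) * vecMulVec (Pi.single 0 1) v := by
    simp [vecMulVec_mul_vecMulVec]
  rw [h, ← blockElem_mul_blockElem, FiniteQuantumSet.psi_tracial, blockElem_mul_blockElem,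
    vecMulVec_mul_vecMulVec, vecMulVec_smul, map_smul, map_smul, smul_eq_mul, mul_comm]
  rfl

lemma blockTrace_ne_zero (i : ι) : blockTrace φ i ≠ 0 := by
  intro h
  have hw : (Pi.single 0 1 : Fin (d i) → ℂ) ≠ 0 := by simp
  exact psi_blockElem_conjCol_ne_zero φ hw (by rw [psi_blockElem_vecMulVec, h, zero_mul])

/-- Brings `ψ (P * a)` to the Rayleigh quotient form of `exists_sum_div_ne_zero`. -/
lemma psi_minProj_mul (i : ι) (w : Fin (d i) → ℂ) (a : A) :
    FiniteQuantumSet.psi (minProj φ i w * a)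
      = blockTrace φ i * (w ⬝ᵥ (φ a i).mulVec (conjCol φ i w)) / (w ⬝ᵥ conjCol φ i w) := by
  rw [minProj, smul_mul_assoc, map_smul, FiniteQuantumSet.psi_tracial, mul_blockElem,
    mul_vecMulVec, psi_blockElem_vecMulVec, smul_eq_mul]
  field_simp

/-- A finite quantum set contains an orthogonal projection that has rank one in each block of size
greater than one, vanishes in the other blocks, and is not orthogonal to any of finitely many given
elements that are not central. -/
theorem exists_isStarProjection_psi_ne_zero [Fintype ι] {J : Type*} [Fintype J] (a : J → A)
    (ha : ∀ j, ∃ x, a j * x ≠ x * a j) :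
    ∃ (P : A) (y w : ∀ i, Fin (d i) → ℂ), IsStarProjection P ∧
      (∀ i, 1 < d i → φ P i = vecMulVec (y i) (w i) ∧ w i ⬝ᵥ y i = 1) ∧
      (∀ i, ¬ 1 < d i → φ P i = 0) ∧ ∀ j, FiniteQuantumSet.psi (P * a j) ≠ 0 := by
  let S : Finset ι := Finset.univ.filter fun i => 1 < d i
  have hS : ∀ i, i ∈ S ↔ 1 < d i := fun i => by simp [S]
  -- A block where `a j` is not scalar has size greater than one, since matrices of size one are
  -- scalar.
  have haS : ∀ j, ∃ i ∈ S, ∀ c, φ (a j) i ≠ Matrix.scalar _ c := fun j => by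
    obtain ⟨i, hi⟩ := exists_ne_scalar_of_not_commute φ (ha j)
    refine ⟨i, (hS i).2 ?_, hi⟩
    by_contra hd
    have hsub : Subsingleton (Fin (d i)) := Fin.subsingleton_iff_le_one.2 (not_lt.1 hd)
    refine hi (φ (a j) i 0 0) ?_
    ext b c
    simp [Subsingleton.elim b 0, Subsingleton.elim c 0]
  obtain ⟨w, hw, hwa⟩ := exists_sum_div_ne_zero S (fun i => NeZero.ne (d i)) (conjCol φ)
    (conjCol_I_smul φ) (dotProduct_conjCol_ne_zero φ) (blockTrace φ) (blockTrace_ne_zero φ)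
    (fun j => φ (a j)) haS
  refine ⟨∑ i ∈ S, minProj φ i (w i), fun i => (w i ⬝ᵥ conjCol φ i (w i))⁻¹ • conjCol φ i (w i), w,
    isStarProjection_sum_minProj φ S hw, fun i hi => ⟨?_, ?_⟩, fun i hi => ?_, fun j => ?_⟩
  · rw [map_sum_minProj, if_pos ((hS i).2 hi)]
  · rw [dotProduct_smul, smul_eq_mul,
      inv_mul_cancel₀ (dotProduct_conjCol_ne_zero φ i _ (hw i ((hS i).2 hi)))]
  · rw [map_sum_minProj, if_neg (mt (hS i).1 hi)]
  · rw [Finset.sum_mul, map_sum]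
    simp only [psi_minProj_mul]
    exact hwa j

end MinimalProjections

/-! ### Application to the group algebra. -/

namespace GroupDual

variable {Γ : Type u} [Group Γ]

/-- The difference of two distinct group elements is central in the group algebra only if both are
central in the group. -/
lemma exists_not_commute_sub {g h : Γ} (hgh : g ≠ h)
    (hc : g ∉ Subgroup.center Γ ∨ h ∉ Subgroup.center Γ) :
    ∃ x : MonoidAlgebra ℂ Γ,
      (MonoidAlgebra.single g⁻¹ 1 - MonoidAlgebra.single h⁻¹ 1) * x
        ≠ x * (MonoidAlgebra.single g⁻¹ 1 - MonoidAlgebra.single h⁻¹ 1) := by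
  classical
  by_contra! H
  have key : ∀ x : Γ, g⁻¹ * x = x * g⁻¹ ∧ h⁻¹ * x = x * h⁻¹ := by
    intro x
    have hx := H (MonoidAlgebra.single x 1)
    simp only [sub_mul, mul_sub, MonoidAlgebra.single_mul_single, one_mul] at hx
    -- The coefficient at `g⁻¹ x` is `1` on the left, and on the right it is positive only if `x g⁻¹
    -- = g⁻¹ x`. At `h⁻¹ x` the signs are reversed.
    have h1 := congrArg (fun y => MonoidAlgebra.coeff y (g⁻¹ * x)) hx
    have h2 := congrArg (fun y => MonoidAlgebra.coeff y (h⁻¹ * x)) hx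
    simp only [MonoidAlgebra.coeff_sub, Finsupp.sub_apply, MonoidAlgebra.coeff_single,
      Finsupp.single_apply] at h1 h2
    constructor
    · by_contra hne
      have hne' : h⁻¹ * x ≠ g⁻¹ * x := by simpa using Ne.symm hgh
      rw [if_pos trivial, if_neg hne', if_neg (Ne.symm hne)] at h1
      split_ifs at h1 <;> norm_num at h1
    · by_contra hne
      have hne' : g⁻¹ * x ≠ h⁻¹ * x := by simpa using hgh
      rw [if_pos trivial, if_neg hne', if_neg (Ne.symm hne)] at h2
      split_ifs at h2 <;> norm_num at h2
  rcases hc with hc | hc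
  · exact hc (inv_mem_iff.1 (Subgroup.mem_center_iff.2 fun x => (key x).1.symm))
  · exact hc (inv_mem_iff.1 (Subgroup.mem_center_iff.2 fun x => (key x).2.symm))

/-- Non-zero vectors of a simple module are cyclic; this is the form of irreducibility used in
`finrank_range_of_irreducible`. -/
lemma exists_asAlgebraHom_apply_eq {V : Type*} [AddCommGroup V] [Module ℂ V]
    (ρ : Representation ℂ Γ V) [ρ.IsIrreducible] {v : V} (hv : v ≠ 0) (x : V) :
    ∃ a, ρ.asAlgebraHom a v = x := by
  have hv' : ρ.asModuleEquiv.symm v ≠ 0 := by simpa using hv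
  obtain ⟨a, ha⟩ := IsSimpleModule.toSpanSingleton_surjective (MonoidAlgebra ℂ Γ) hv'
    (ρ.asModuleEquiv.symm x)
  refine ⟨a, ?_⟩
  have h := congrArg ρ.asModuleEquiv ha
  rwa [LinearMap.toSpanSingleton_apply, Representation.asModuleEquiv_map_smul,
    LinearEquiv.apply_symm_apply, LinearEquiv.apply_symm_apply] at h

end GroupDual

theorem theoremB (Γ : Type u) [Group Γ] [Fintype Γ] (hΓ : ∃ a b : Γ, a * b ≠ b * a) :
    ∃ P : MonoidAlgebra ℂ Γ,
      -- `P` is an orthogonal projection in `C(Γ̂) = ℂ[Γ]`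
      IsStarProjection P ∧
      -- `(Γ̂, A_P)` with `A_P = P ⋆ ·` is a quantum graph
      IsQuantumGraph (cayleyAdjacency P) ∧
      -- `Qut(Γ̂, A_P) = Γ̂`, acting on itself by its comultiplication
      IsQuantumAutomorphismGroup.{u, u, v} (cayleyAdjacency P)
        (comulAction (MonoidAlgebra ℂ Γ)) ∧
      -- `P` has rank one in each block of dimension `> 1` and vanishes in the other blocks
      (∀ (n : ℕ) (ρ : Representation ℂ Γ (Fin n → ℂ)), ρ.IsIrreducible →
        Module.finrank ℂ (LinearMap.range (ρ.asAlgebraHom P)) = if 1 < n then 1 else 0) ∧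
      -- the Fourier transform of `P` separates two elements one of which is not central
      (∀ g h : Γ, g ≠ h → (g ∉ Subgroup.center Γ ∨ h ∉ Subgroup.center Γ) →
        P.coeff g ≠ P.coeff h) := by
  classical
  have : FiniteDimensional ℂ (MonoidAlgebra ℂ Γ) := FiniteQuantumSet.finite
  have : NeZero (Nat.card Γ : ℂ) := ⟨by simp⟩
  obtain ⟨m, d, hd, ⟨φ⟩⟩ := IsSemisimpleRing.exists_algEquiv_pi_matrix_of_isAlgClosed ℂ
    (MonoidAlgebra ℂ Γ)
  -- The finitely many pairs to be separated, each giving one non-vanishing condition on `P`.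
  let J := {p : Γ × Γ // p.1 ≠ p.2 ∧ (p.1 ∉ Subgroup.center Γ ∨ p.2 ∉ Subgroup.center Γ)}
  obtain ⟨P, y, w, hP, hP1, hP0, hPJ⟩ := exists_isStarProjection_psi_ne_zero φ
    (fun j : J => MonoidAlgebra.single j.1.1⁻¹ 1 - MonoidAlgebra.single j.1.2⁻¹ 1)
    fun j => GroupDual.exists_not_commute_sub j.2.1 j.2.2
  have hT : ∀ g h : Γ, g ≠ h → (g ∉ Subgroup.center Γ ∨ h ∉ Subgroup.center Γ) →
      P.coeff g ≠ P.coeff h := by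
    intro g h hgh hc heq
    refine hPJ ⟨(g, h), hgh, hc⟩ ?_
    rw [mul_sub, map_sub, GroupDual.psi_eq, GroupDual.psi_eq, GroupDual.coeff_mul_single_inv,
      GroupDual.coeff_mul_single_inv, heq, sub_self]
  refine ⟨P, hP, GroupDual.isQuantumGraph_cayleyAdjacency hP,
    GroupDual.isQuantumAutomorphismGroup_comulAction hΓ hT, fun n ρ hρ => ?_, hT⟩
  have : Nontrivial (Fin n → ℂ) := by
    have := IsSimpleModule.nontrivial (MonoidAlgebra ℂ Γ) ρ.asModule
    exact ρ.asModuleEquiv.symm.toEquiv.nontrivial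
  have h := finrank_range_of_irreducible φ ρ.asAlgebraHom
    (fun v hv x => GroupDual.exists_asAlgebraHom_apply_eq ρ hv x) hP1 hP0
  rwa [Module.finrank_fin_fun] at h
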